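/- Let $\Sigma$ and $\Gamma$ be finite alphabets. An \emph{origin graph} is a triple $(u,v,o)$ with $u\in\Sigma^+$, $v\in\Gamma^*$ and $o$ a map from the positions of $v$ to the positions of $u$; an \emph{o-transduction} is a set of origin graphs, and its \emph{origin-free projection} is the set of the pairs $(u,v)$ such that $(u,v,o)$ belongs to it for some $o$. An origin graph is regarded as a structure whose domain is the disjoint union of the positions of $u$ and of $v$. The logic $\mathcal L_T$ is two-variable first-order logic over these structures with the output letters $\gamma(x)$, $\gamma\in\Gamma$, the order $\le_{\mathrm{out}}$ of the output positions, the origin function (the identity on input positions), and every predicate of arity $0$, $1$ or $2$ on input positions that is definable over the input word by a formula of $\mathrm{MSO}[\le_{\mathrm{in}},\Sigma]$. An o-transduction is $\mathcal L_T$-definable if it is the set of models of some sentence of $\mathcal L_T$, and a transduction is $\mathcal L_T$-definable if it is the origin-free projection of such a set. A deterministic two-way transducer reads $u$ between two endmarkers, each of its transitions outputs a word over $\Gamma$, and an accepting run is one that stops, for want of an applicable transition, in a final state. The origin of an output letter is the position of $u$ that is read when the letter is output (the first, respectively last, position of $u$ if the left, respectively right, endmarker is read). A deterministic MSO-transducer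 consists of a number $k$ of copies, an $\mathrm{MSO}[\le_{\mathrm{in}},\Sigma]$ sentence defining the domain, and $\mathrm{MSO}[\le_{\mathrm{in}},\Sigma]$ formulas that specify, for all copies $c,d\in\{1,\dots,k\}$ and all $\gamma\in\Gamma$, which input positions $x$ have their $c$-th copy in the output, whether that copy is labelled $\gamma$, and whether the $c$-th copy of $x$ precedes or equals the $d$-th copy of $y$ in the output; it produces an output on those inputs in the domain for which the resulting structure is a word, and the origin of a copy of $x$ is $x$. \textbf{Theorem.} Every regular function is $\mathcal L_T$-definable, with its origin semantics: every o-transduction that is the set of origin graphs of a deterministic two-way transducer with finitely many states, and every o-transduction that is the set of origin graphs of a deterministic MSO-transducer, is $\mathcal L_T$-definable. Consequently, the origin-free transductions of these transducers are $\mathcal L_T$-definable as well. -/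

import Mathlib

universe u v

/-! ### Origin graphs -/

/-- An origin graph `(u, (v, o))` with `u` a nonempty word over `A`, `v` a word over `B` and
`o` a map from the positions of `v` to the positions of `u`. Positions are numbered from `0`. -/
structure OGraph (A : Type u) (B : Type v) where
  input : List A
  input_ne : input ≠ []
  output : List B
  origin : Fin output.length → Fin input.length

/-- An o-transduction is a set of origin graphs. -/
abbrev OTransduction (A : Type u) (B : Type v) := Set (OGraph A B)

/-- A transduction is a set of pairs of a nonempty input word and an output word. -/
abbrev Transduction (A : Type u) (B : Type v) := Set ({w : List A // w ≠ []} × List B)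

/-- The origin-free projection of an o-transduction. -/
def OTransduction.originFree {A : Type u} {B : Type v} (τ : OTransduction A B) :
    Transduction A B :=
  {p | ∃ G ∈ τ, G.input = p.1.1 ∧ G.output = p.2}

/-! ### Monadic second-order logic over words -/

/-- Formulas of monadic second-order logic over words on the alphabet `A`, with the position
order and the letter predicates, whose free first-order variables are among `n` variables
and whose free set variables are among `m` variables. In the scope of a quantifier, the newly
bound variable has index `0` and the others are shifted by one. -/
inductive MSO (A : Type u) : ℕ → ℕ → Type u
  | letter {n m : ℕ} (a : A) (i : Fin n) : MSO A n m
  | le {n m : ℕ} (i j : Fin n) : MSO A n m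
  | mem {n m : ℕ} (i : Fin n) (X : Fin m) : MSO A n m
  | neg {n m : ℕ} (φ : MSO A n m) : MSO A n m
  | and {n m : ℕ} (φ ψ : MSO A n m) : MSO A n m
  | exFO {n m : ℕ} (φ : MSO A (n + 1) m) : MSO A n m
  | exSO {n m : ℕ} (φ : MSO A n (m + 1)) : MSO A n m

/-- Satisfaction of an MSO formula in the word `w`, under the assignment `s` of positions to the
first-order variables and `S` of sets of positions to the set variables. -/
def MSO.Holds {A : Type u} (w : List A) : {n m : ℕ} → MSO A n m →
    (Fin n → Fin w.length) → (Fin m → Set (Fin w.length)) → Prop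
  | _, _, .letter a i, s, _ => w.get (s i) = a
  | _, _, .le i j, s, _ => s i ≤ s j
  | _, _, .mem i X, s, S => s i ∈ S X
  | _, _, .neg φ, s, S => ¬ φ.Holds w s S
  | _, _, .and φ ψ, s, S => φ.Holds w s S ∧ ψ.Holds w s S
  | _, _, .exFO φ, s, S => ∃ p : Fin w.length, φ.Holds w (Fin.cons p s) S
  | _, _, .exSO φ, s, S => ∃ P : Set (Fin w.length), φ.Holds w s (Fin.cons P S)

/-- The `n`-ary relation on the positions of `w` defined by an MSO formula without free set
variables. -/
def MSO.Rel {A : Type u} {n : ℕ} (φ : MSO A n 0) (w : List A) (s : Fin n → Fin w.length) : Prop :=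
  φ.Holds w s Fin.elim0

/-! ### The logic `L_T` -/

/-- The two variables of `L_T`. -/
inductive LTVar
  | x
  | y
  deriving DecidableEq

/-- Terms of `L_T`: variables, closed under the origin function. -/
inductive LTTerm
  | var (z : LTVar)
  | orig (t : LTTerm)

/-- Formulas of `L_T`, that is, of two-variable first-order logic over the output letters, the
output order, the origin function, and all predicates of arity `0`, `1` or `2` defined by MSO
formulas over the input word. Both variables may be requantified. Equality is definable, by
`t ≤ s ∧ s ≤ t` for the output order or for the input order. -/
inductive LTFormula (A : Type u) (B : Type v) : Type (max u v)
  | letter (b : B) (t : LTTerm)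
  | leOut (t s : LTTerm)
  | inp0 (φ : MSO A 0 0)
  | inp1 (φ : MSO A 1 0) (t : LTTerm)
  | inp2 (φ : MSO A 2 0) (t s : LTTerm)
  | neg (φ : LTFormula A B)
  | and (φ ψ : LTFormula A B)
  | ex (z : LTVar) (φ : LTFormula A B)

/-- The variable occurring in a term. -/
def LTTerm.variable : LTTerm → LTVar
  | .var z => z
  | .orig t => t.variable

/-- The free variables of a formula. -/
def LTFormula.free {A : Type u} {B : Type v} : LTFormula A B → Set LTVar
  | .letter _ t => {t.variable}
  | .leOut t s => {t.variable, s.variable}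
  | .inp0 _ => ∅
  | .inp1 _ t => {t.variable}
  | .inp2 _ t s => {t.variable, s.variable}
  | .neg φ => φ.free
  | .and φ ψ => φ.free ∪ ψ.free
  | .ex z φ => φ.free \ {z}

/-- A sentence is a formula without free variables. -/
def LTFormula.IsSentence {A : Type u} {B : Type v} (φ : LTFormula A B) : Prop := φ.free = ∅

/-- The domain of the structure of an origin graph: the disjoint union of the input positions and
of the output positions. -/
abbrev OGraph.Node {A : Type u} {B : Type v} (G : OGraph A B) : Type :=
  Fin G.input.length ⊕ Fin G.output.length

/-- The origin function on nodes, extended by the identity to the input positions. -/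
def OGraph.originNode {A : Type u} {B : Type v} (G : OGraph A B) : G.Node → G.Node
  | .inl i => .inl i
  | .inr j => .inl (G.origin j)

/-- The value of a term. -/
def LTTerm.eval {A : Type u} {B : Type v} (G : OGraph A B) (s : LTVar → G.Node) : LTTerm → G.Node
  | .var z => s z
  | .orig t => G.originNode (t.eval G s)

/-- Satisfaction of a formula of `L_T` in an origin graph, under an assignment of nodes to the two
variables. Output predicates hold of output positions only, input predicates of input positions
only. -/
def LTFormula.Holds {A : Type u} {B : Type v} (G : OGraph A B) :
    LTFormula A B → (LTVar → G.Node) → Prop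
  | .letter b t, s => ∃ j, t.eval G s = .inr j ∧ G.output.get j = b
  | .leOut t t', s => ∃ j j', t.eval G s = .inr j ∧ t'.eval G s = .inr j' ∧ j ≤ j'
  | .inp0 φ, _ => φ.Rel G.input ![]
  | .inp1 φ t, s => ∃ i, t.eval G s = .inl i ∧ φ.Rel G.input ![i]
  | .inp2 φ t t', s => ∃ i i', t.eval G s = .inl i ∧ t'.eval G s = .inl i' ∧
      φ.Rel G.input ![i, i']
  | .neg φ, s => ¬ φ.Holds G s
  | .and φ ψ, s => φ.Holds G s ∧ ψ.Holds G s
  | .ex z φ, s => ∃ p : G.Node, φ.Holds G (Function.update s z p)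

/-- The o-transduction defined by a formula, meant for sentences. For these the assignment is
irrelevant (and there is one, since the input word is nonempty). -/
def LTFormula.oSem {A : Type u} {B : Type v} (φ : LTFormula A B) : OTransduction A B :=
  {G | ∀ s : LTVar → G.Node, φ.Holds G s}

/-- An o-transduction is `L_T`-definable if it is the set of models of a sentence of `L_T`. -/
def OTransduction.IsLTDefinable {A : Type u} {B : Type v} (τ : OTransduction A B) : Prop :=
  ∃ φ : LTFormula A B, φ.IsSentence ∧ φ.oSem = τ

/-- A transduction is `L_T`-definable if it is the origin-free projection of the set of models of
a sentence of `L_T`. -/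
def Transduction.IsLTDefinable {A : Type u} {B : Type v} (f : Transduction A B) : Prop :=
  ∃ φ : LTFormula A B, φ.IsSentence ∧ φ.oSem.originFree = f

/-! ### Deterministic two-way transducers -/

/-- The symbols on the tape: left endmarker, letters, right endmarker. -/
inductive TapeSymbol (A : Type u) : Type u
  | left
  | letter (a : A)
  | right

/-- The moves of the head. -/
inductive Move
  | left
  | stay
  | right

/-- The tape carries the word `w` on the cells `1, …, |w|`, between the left endmarker on the cell
`0` and the right endmarker on the cell `|w| + 1`. -/
def tapeSymbol {A : Type u} (w : List A) : ℕ → TapeSymbol A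
  | 0 => .left
  | p + 1 => if h : p < w.length then .letter (w.get ⟨p, h⟩) else .right

/-- The cell on which the head is after a move. -/
def Move.apply : Move → ℕ → ℕ
  | .left, p => p - 1
  | .stay, p => p
  | .right, p => p + 1

/-- A deterministic two-way transducer with set of states `Q`: a deterministic two-way automaton
each of whose transitions carries an output word. There is at most one transition for each
state and each symbol read, and the head never leaves the tape. -/
structure TwoWayTransducer (A : Type u) (B : Type v) (Q : Type) where
  init : Q
  final : Set Q
  trans : Q → TapeSymbol A → Option (Q × Move × List B)
  no_left : ∀ q q' out, trans q .left ≠ some (q', .left, out)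
  no_right : ∀ q q' out, trans q .right ≠ some (q', .right, out)

/-- The input position (numbered from `0`) that is the origin of the letters output while the head
reads the cell `p`, for an input word of length `n > 0`: the position in that cell, or the nearest
position (the first, respectively the last one) if the cell carries an endmarker. -/
def cellOrigin (n p : ℕ) : ℕ := min (p - 1) (n - 1)

/-- `T.Run w q p out`: on the input word `w`, the transducer reaches from its initial configuration
the state `q` with the head on the cell `p`, having output the letters listed in `out`,
each with its origin. -/
inductive TwoWayTransducer.Run {A : Type u} {B : Type v} {Q : Type} (T : TwoWayTransducer A B Q)
    (w : List A) : Q → ℕ → List (B × ℕ) → Prop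
  | init : T.Run w T.init 0 []
  | step {q : Q} {p : ℕ} {out : List (B × ℕ)} {q' : Q} {d : Move} {l : List B}
      (h : T.Run w q p out) (ht : T.trans q (tapeSymbol w p) = some (q', d, l)) :
      T.Run w q' (d.apply p) (out ++ l.map fun b => (b, cellOrigin w.length p))

/-- The word of an accepting run, with origins: the run is accepting if it stops, for want of a
transition, in a final state. -/
def TwoWayTransducer.Accepts {A : Type u} {B : Type v} {Q : Type} (T : TwoWayTransducer A B Q)
    (w : List A) (out : List (B × ℕ)) : Prop :=
  ∃ q p, T.Run w q p out ∧ T.trans q (tapeSymbol w p) = none ∧ q ∈ T.final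

/-- The o-transduction of a deterministic two-way transducer. -/
def TwoWayTransducer.oSem {A : Type u} {B : Type v} {Q : Type} (T : TwoWayTransducer A B Q) :
    OTransduction A B :=
  {G | T.Accepts G.input (List.ofFn fun j => (G.output.get j, (G.origin j : ℕ)))}

/-- An o-transduction is regular if it is the set of origin graphs of a deterministic two-way
transducer with finitely many states. -/
def OTransduction.IsRegular {A : Type u} {B : Type v} (τ : OTransduction A B) : Prop :=
  ∃ (Q : Type) (_ : Finite Q) (T : TwoWayTransducer A B Q), T.oSem = τ

/-- A transduction is a regular function if it is the origin-free transduction of a deterministic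
two-way transducer with finitely many states. -/
def Transduction.IsRegular {A : Type u} {B : Type v} (f : Transduction A B) : Prop :=
  ∃ (Q : Type) (_ : Finite Q) (T : TwoWayTransducer A B Q), T.oSem.originFree = f

/-! ### Deterministic MSO-transducers -/

/-- A deterministic MSO-transducer: a number of copies, a domain sentence, and for all copies the
formulas that define the positions, the labels and the order of the output. -/
structure MSOTransducer (A : Type u) (B : Type v) where
  copies : ℕ
  dom : MSO A 0 0
  pos : Fin copies → MSO A 1 0
  lab : Fin copies → B → MSO A 1 0
  ord : Fin copies → Fin copies → MSO A 2 0

/-- The domain of the output structure for the input word `w`: the copies that are kept. -/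
def MSOTransducer.OutNode {A : Type u} {B : Type v} (T : MSOTransducer A B) (w : List A) : Type :=
  {n : Fin T.copies × Fin w.length // (T.pos n.1).Rel w ![n.2]}

/-- The o-transduction of an MSO-transducer: the origin graphs whose input satisfies the domain
sentence and whose output word is isomorphic to the output structure, where the origin of the
copy of an input position is that position. -/
def MSOTransducer.oSem {A : Type u} {B : Type v} (T : MSOTransducer A B) : OTransduction A B :=
  {G | T.dom.Rel G.input ![] ∧
    ∃ e : Fin G.output.length ≃ T.OutNode G.input,
      (∀ j, G.origin j = (e j).1.2) ∧
      (∀ j b, G.output.get j = b ↔ (T.lab (e j).1.1 b).Rel G.input ![(e j).1.2]) ∧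
      (∀ j j', j ≤ j' ↔
        (T.ord (e j).1.1 (e j').1.1).Rel G.input ![(e j).1.2, (e j').1.2])}

/-- An o-transduction defined by a deterministic MSO-transducer. -/
def OTransduction.IsMSOTransduction {A : Type u} {B : Type v} (τ : OTransduction A B) : Prop :=
  ∃ T : MSOTransducer A B, T.oSem = τ

/-- A transduction defined, without origins, by a deterministic MSO-transducer. -/
def Transduction.IsMSOTransduction {A : Type u} {B : Type v} (f : Transduction A B) : Prop :=
  ∃ T : MSOTransducer A B, T.oSem.originFree = f

/-!
Definability is handled semantically: a property of words (or of origin graphs) is `Definable` if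
some formula has it as its satisfaction relation, and these properties are closed under Boolean
operations, finite disjunctions and quantifiers. As the transitive closure of a definable relation
between copies of positions can be expressed by quantifying over one set for each copy
(`MSO.Definable.reflTransGen`), MSO can speak of reachability between configurations.

For MSO-transducers, the difficulty is that an output position `j` carries its origin `i` but
not the copy of `i` that it stands for. The output positions of origin `i` are ordered as
the kept copies of `i` are, and there are at most as many of them as there are copies. So `j` stands
for the copy whose rank among the kept copies of `i`, an MSO-definable number, is the rank of `j` in
the fibre of the origin map. The latter is definable with two variables, by the recursion
`OGraph.succ_le_rank_iff` in which the variables are requantified in turn. Once the copy is known,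
labels and order are compared with the formulas of the transducer by quantifying over at most two
nodes (`WordInterpretation.mem_oSem_iff`).

A two-way transducer is turned into such an interpretation. The copies of a position are the triples
of a state, a kind of cell (the cell of that position, or an endmarker next to it) and an index of
a letter in the output of a transition; a copy is kept if its configuration is reachable and outputs
a letter of that index, and the order is reachability. In a deterministic run that halts no
configuration recurs (`TwoWayTransducer.not_transGen_self`), so that, on the inputs with
an accepting run, the order is the order of output (`TwoWayTransducer.exists_outputCopies`).
-/

/-! ### Definability in MSO -/

/-- Renaming of the free first-order variables along `f` and of the free set variables
along `g`. -/
def MSO.rename {A : Type u} : {n m : ℕ} → MSO A n m → {n' m' : ℕ} →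
    (Fin n → Fin n') → (Fin m → Fin m') → MSO A n' m'
  | _, _, .letter a i, _, _, f, _ => .letter a (f i)
  | _, _, .le i j, _, _, f, _ => .le (f i) (f j)
  | _, _, .mem i X, _, _, f, g => .mem (f i) (g X)
  | _, _, .neg φ, _, _, f, g => .neg (φ.rename f g)
  | _, _, .and φ ψ, _, _, f, g => .and (φ.rename f g) (ψ.rename f g)
  | _, _, .exFO φ, _, _, f, g => .exFO (φ.rename (Fin.cons 0 (Fin.succ ∘ f)) g)
  | _, _, .exSO φ, _, _, f, g => .exSO (φ.rename f (Fin.cons 0 (Fin.succ ∘ g)))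

theorem MSO.holds_rename {A : Type u} (w : List A) {n m : ℕ} (φ : MSO A n m) {n' m' : ℕ}
    (f : Fin n → Fin n') (g : Fin m → Fin m') (s : Fin n' → Fin w.length)
    (S : Fin m' → Set (Fin w.length)) :
    (φ.rename f g).Holds w s S ↔ φ.Holds w (s ∘ f) (S ∘ g) := by
  have key : ∀ {α : Type} {k k' : ℕ} (h : Fin k → Fin k') (p : α) (t : Fin k' → α),
      (Fin.cons p t : Fin (k' + 1) → α) ∘ (Fin.cons 0 (Fin.succ ∘ h) : Fin (k + 1) → Fin (k' + 1))
        = Fin.cons p (t ∘ h) := by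
    intro α k k' h p t
    funext i
    refine Fin.cases ?_ (fun i => ?_) i <;> simp
  induction φ generalizing n' m' with
  | letter a i => rfl
  | le i j => rfl
  | mem i X => rfl
  | neg φ ih => simp only [MSO.rename, MSO.Holds, ih]
  | and φ ψ ih₁ ih₂ => simp only [MSO.rename, MSO.Holds, ih₁, ih₂]
  | exFO φ ih => simp only [MSO.rename, MSO.Holds, ih, key]
  | exSO φ ih => simp only [MSO.rename, MSO.Holds, ih, key]

/-- A property of words with distinguished positions `s` and sets of positions `S` is definable
if it is the satisfaction relation of an MSO formula. -/
def MSO.Definable {A : Type u} {n m : ℕ}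
    (P : (w : List A) → (Fin n → Fin w.length) → (Fin m → Set (Fin w.length)) → Prop) : Prop :=
  ∃ φ : MSO A n m, ∀ w s S, φ.Holds w s S ↔ P w s S

namespace MSO.Definable

variable {A : Type u} {n m : ℕ}
  {P R : (w : List A) → (Fin n → Fin w.length) → (Fin m → Set (Fin w.length)) → Prop}

theorem congr (hP : MSO.Definable P) (h : ∀ w s S, P w s S ↔ R w s S) : MSO.Definable R :=
  hP.imp fun _ hφ w s S => (hφ w s S).trans (h w s S)

theorem not (hP : MSO.Definable P) : MSO.Definable fun w s S => ¬ P w s S :=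
  let ⟨φ, hφ⟩ := hP
  ⟨.neg φ, fun w s S => not_congr (hφ w s S)⟩

theorem and (hP : MSO.Definable P) (hR : MSO.Definable R) :
    MSO.Definable fun w s S => P w s S ∧ R w s S :=
  let ⟨φ, hφ⟩ := hP
  let ⟨ψ, hψ⟩ := hR
  ⟨.and φ ψ, fun w s S => and_congr (hφ w s S) (hψ w s S)⟩

theorem or (hP : MSO.Definable P) (hR : MSO.Definable R) :
    MSO.Definable fun w s S => P w s S ∨ R w s S :=
  (hP.not.and hR.not).not.congr fun _ _ _ => by tauto

theorem imp (hP : MSO.Definable P) (hR : MSO.Definable R) :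
    MSO.Definable fun w s S => P w s S → R w s S :=
  (hP.and hR.not).not.congr fun _ _ _ => by tauto

theorem iff (hP : MSO.Definable P) (hR : MSO.Definable R) :
    MSO.Definable fun w s S => P w s S ↔ R w s S :=
  ((hP.imp hR).and (hR.imp hP)).congr fun _ _ _ => by tauto

theorem const (p : Prop) : MSO.Definable fun (w : List A) (_ : Fin n → Fin w.length)
    (_ : Fin m → Set (Fin w.length)) => p := by
  have hle : MSO.Definable fun (w : List A) (_ : Fin n → Fin w.length)
      (_ : Fin m → Set (Fin w.length)) => ∃ q : Fin w.length, q ≤ q :=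
    ⟨.exFO (.le 0 0), fun _ _ _ => Iff.rfl⟩
  by_cases hp : p
  · exact (hle.and hle.not).not.congr fun _ _ _ => by tauto
  · exact (hle.and hle.not).congr fun _ _ _ => by tauto

theorem exists_finite {ι : Type*} [Finite ι]
    {F : ι → (w : List A) → (Fin n → Fin w.length) → (Fin m → Set (Fin w.length)) → Prop}
    (hF : ∀ k, MSO.Definable (F k)) : MSO.Definable fun w s S => ∃ k, F k w s S := by
  classical
  have := Fintype.ofFinite ι
  have key : ∀ t : Finset ι, MSO.Definable fun w s S => ∃ k ∈ t, F k w s S := by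
    intro t
    induction t using Finset.induction_on with
    | empty => exact (const False).congr fun _ _ _ => by simp
    | insert k t _ ih => exact ((hF k).or ih).congr fun _ _ _ => by simp
  exact (key Finset.univ).congr fun _ _ _ => by simp

theorem forall_finite {ι : Type*} [Finite ι]
    {F : ι → (w : List A) → (Fin n → Fin w.length) → (Fin m → Set (Fin w.length)) → Prop}
    (hF : ∀ k, MSO.Definable (F k)) : MSO.Definable fun w s S => ∀ k, F k w s S :=
  (exists_finite fun k => (hF k).not).not.congr fun _ _ _ => by simp

/-- For finitely many definable properties `F k`, every property of the set of those `k` for which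
`F k` holds is definable. -/
theorem of_finite_set {ι : Type*} [Finite ι] (Q : Set ι → Prop)
    {F : ι → (w : List A) → (Fin n → Fin w.length) → (Fin m → Set (Fin w.length)) → Prop}
    (hF : ∀ k, MSO.Definable (F k)) : MSO.Definable fun w s S => Q {k | F k w s S} :=
  (exists_finite fun D : Set ι => (const (Q D)).and
    (forall_finite fun k => (const (k ∈ D)).iff (hF k))).congr fun w s S => by
      constructor
      · rintro ⟨D, hD, h⟩
        convert hD
        ext k
        exact (h k).symm
      · exact fun h => ⟨_, h, fun _ => Iff.rfl⟩

theorem exFO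
    {P : (w : List A) → (Fin (n + 1) → Fin w.length) → (Fin m → Set (Fin w.length)) → Prop}
    (hP : MSO.Definable P) : MSO.Definable fun w s S => ∃ p, P w (Fin.cons p s) S :=
  let ⟨φ, hφ⟩ := hP
  ⟨.exFO φ, fun w _ S => exists_congr fun _ => hφ w _ S⟩

theorem allFO
    {P : (w : List A) → (Fin (n + 1) → Fin w.length) → (Fin m → Set (Fin w.length)) → Prop}
    (hP : MSO.Definable P) : MSO.Definable fun w s S => ∀ p, P w (Fin.cons p s) S :=
  hP.not.exFO.not.congr fun _ _ _ => by simp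

/-- Quantification over all set variables at once. -/
theorem exSO_tuple : ∀ {m : ℕ}
    {P : (w : List A) → (Fin n → Fin w.length) → (Fin m → Set (Fin w.length)) → Prop}
    (_ : MSO.Definable P),
    MSO.Definable fun w s (_ : Fin 0 → Set (Fin w.length)) => ∃ S, P w s S
  | 0, _, hP => hP.congr fun w s S => by
      constructor
      · exact fun h => ⟨_, h⟩
      · rintro ⟨S', h⟩
        rwa [Subsingleton.elim S S']
  | m + 1, P, ⟨φ, hφ⟩ =>
    have h : MSO.Definable fun w s (S : Fin m → Set (Fin w.length)) =>
        ∃ X, P w s (Fin.cons X S) :=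
      ⟨.exSO φ, fun w s S => exists_congr fun _ => hφ w s _⟩
    (exSO_tuple h).congr fun w s _ => by
      constructor
      · rintro ⟨S, X, h⟩
        exact ⟨_, h⟩
      · rintro ⟨S, h⟩
        refine ⟨Fin.tail S, S 0, ?_⟩
        rwa [Fin.cons_self_tail]

theorem rename {n' m' : ℕ} (hP : MSO.Definable P) (f : Fin n → Fin n') (g : Fin m → Fin m') :
    MSO.Definable fun w (s : Fin n' → Fin w.length) (S : Fin m' → Set (Fin w.length)) =>
      P w (s ∘ f) (S ∘ g) :=
  let ⟨φ, hφ⟩ := hP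
  ⟨φ.rename f g, fun w s S => (MSO.holds_rename w φ f g s S).trans (hφ w _ _)⟩

theorem le (i j : Fin n) : MSO.Definable fun (w : List A) (s : Fin n → Fin w.length)
    (_ : Fin m → Set (Fin w.length)) => s i ≤ s j :=
  ⟨.le i j, fun _ _ _ => Iff.rfl⟩

theorem mem (i : Fin n) (X : Fin m) : MSO.Definable fun (w : List A) (s : Fin n → Fin w.length)
    (S : Fin m → Set (Fin w.length)) => s i ∈ S X :=
  ⟨.mem i X, fun _ _ _ => Iff.rfl⟩

theorem letter (a : A) (i : Fin n) : MSO.Definable fun (w : List A) (s : Fin n → Fin w.length)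
    (_ : Fin m → Set (Fin w.length)) => w.get (s i) = a :=
  ⟨.letter a i, fun _ _ _ => Iff.rfl⟩

theorem eq (i j : Fin n) : MSO.Definable fun (w : List A) (s : Fin n → Fin w.length)
    (_ : Fin m → Set (Fin w.length)) => s i = s j :=
  ((le i j).and (le j i)).congr fun _ _ _ => le_antisymm_iff.symm

/-- The first position is the one that precedes or equals all positions. -/
theorem val_eq_zero (i : Fin n) : MSO.Definable fun (w : List A) (s : Fin n → Fin w.length)
    (_ : Fin m → Set (Fin w.length)) => (s i : ℕ) = 0 :=
  (le (m := m) i.succ 0).allFO.congr fun w s _ => by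
    simp only [Fin.cons_succ, Fin.cons_zero]
    constructor
    · intro h
      exact Nat.le_zero.1 (h ⟨0, (Nat.zero_le _).trans_lt (s i).2⟩)
    · intro h p
      exact Fin.le_def.2 (h ▸ Nat.zero_le _)

theorem val_succ_eq_length (i : Fin n) : MSO.Definable fun (w : List A)
    (s : Fin n → Fin w.length) (_ : Fin m → Set (Fin w.length)) => (s i : ℕ) + 1 = w.length :=
  (le (m := m) 0 i.succ).allFO.congr fun w s _ => by
    simp only [Fin.cons_succ, Fin.cons_zero]
    have hs := (s i).2
    constructor
    · intro h
      have := Fin.le_def.1 (h ⟨w.length - 1, by omega⟩)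
      simp only at this
      omega
    · intro h p
      have := p.2
      exact Fin.le_def.2 (by omega)

theorem val_eq_val_succ (i j : Fin n) : MSO.Definable fun (w : List A)
    (s : Fin n → Fin w.length) (_ : Fin m → Set (Fin w.length)) => (s j : ℕ) = s i + 1 :=
  ((le (m := m) j i).not.and
    ((le (m := m) 0 i.succ).or (le j.succ 0)).allFO).congr fun w s _ => by
    simp only [Fin.cons_succ, Fin.cons_zero, Fin.le_def]
    constructor
    · rintro ⟨h₁, h₂⟩
      have := h₂ ⟨s i + 1, by have := (s j).2; omega⟩
      simp only at this
      omega
    · intro h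
      exact ⟨by omega, fun p => by omega⟩

/-- The reflexive transitive closure of a definable relation between copies of positions is
definable: `b` is reachable from `a` if it belongs to each family of sets, one for each copy, that
contains `a` and is closed under the relation. -/
theorem reflTransGen {K : Type*} [Finite K]
    {R : (w : List A) → K × Fin w.length → K × Fin w.length → Prop}
    (hR : ∀ k k', MSO.Definable fun w (s : Fin 2 → Fin w.length)
      (_ : Fin 0 → Set (Fin w.length)) => R w (k, s 0) (k', s 1))
    (k k' : K) (i j : Fin n) : MSO.Definable fun w (s : Fin n → Fin w.length)
      (_ : Fin 0 → Set (Fin w.length)) => Relation.ReflTransGen (R w) (k, s i) (k', s j) := by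
  obtain ⟨N, ⟨e⟩⟩ := Finite.exists_equiv_fin K
  have hclosed : MSO.Definable fun (w : List A) (s : Fin n → Fin w.length)
      (S : Fin N → Set (Fin w.length)) =>
      ∀ c d : K, ∀ p q, p ∈ S (e c) ∧ R w (c, p) (d, q) → q ∈ S (e d) := by
    refine forall_finite fun c => forall_finite fun d => ?_
    have h := (((mem (A := A) (n := n + 1 + 1) (1 : Fin (n + 1 + 1)) (e c)).and
      ((hR c d).rename (![1, 0] : Fin 2 → Fin (n + 1 + 1)) Fin.elim0)).imp
      (mem (0 : Fin (n + 1 + 1)) (e d))).allFO.allFO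
    exact h.congr fun w s S => Iff.rfl
  -- The negation of: some closed family contains `(k, s i)` but not `(k', s j)`.
  refine ((((hclosed.and (mem i (e k))).and (mem j (e k')).not).exSO_tuple).not).congr
    fun w s _ => ?_
  simp only [not_exists, not_and, not_not, and_imp]
  constructor
  · intro h
    refine h (fun c => {p | Relation.ReflTransGen (R w) (k, s i) (e.symm c, p)}) ?_ ?_ |>.trans ?_
    · intro c d p q hp hpq
      simp only [Set.mem_ofPred_eq, Equiv.symm_apply_apply] at hp ⊢
      exact hp.tail hpq
    · simp only [Set.mem_ofPred_eq, Equiv.symm_apply_apply]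
      exact .refl
    · simp only [Equiv.symm_apply_apply]
      exact .refl
  · intro h S hS hk
    have : ∀ b, Relation.ReflTransGen (R w) (k, s i) b → b.2 ∈ S (e b.1) := by
      intro b hb
      induction hb with
      | refl => exact hk
      | tail _ hbc ih => exact hS _ _ _ _ ih hbc
    exact this _ h

end MSO.Definable

/-! ### Definability in the two-variable logic -/

/-- A property of origin graphs under an assignment of nodes to the two variables is definable
if it is the satisfaction relation of a formula of `L_T`. -/
def LTFormula.Definable {A : Type u} {B : Type v}
    (P : (G : OGraph A B) → (LTVar → G.Node) → Prop) : Prop :=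
  ∃ φ : LTFormula A B, ∀ G s, φ.Holds G s ↔ P G s

namespace LTFormula.Definable

variable {A : Type u} {B : Type v} {P R : (G : OGraph A B) → (LTVar → G.Node) → Prop}

theorem congr (hP : LTFormula.Definable P) (h : ∀ G s, P G s ↔ R G s) : LTFormula.Definable R :=
  hP.imp fun _ hφ G s => (hφ G s).trans (h G s)

theorem not (hP : LTFormula.Definable P) : LTFormula.Definable fun G s => ¬ P G s :=
  let ⟨φ, hφ⟩ := hP
  ⟨.neg φ, fun G s => not_congr (hφ G s)⟩

theorem and (hP : LTFormula.Definable P) (hR : LTFormula.Definable R) :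
    LTFormula.Definable fun G s => P G s ∧ R G s :=
  let ⟨φ, hφ⟩ := hP
  let ⟨ψ, hψ⟩ := hR
  ⟨.and φ ψ, fun G s => and_congr (hφ G s) (hψ G s)⟩

theorem or (hP : LTFormula.Definable P) (hR : LTFormula.Definable R) :
    LTFormula.Definable fun G s => P G s ∨ R G s :=
  (hP.not.and hR.not).not.congr fun _ _ => by tauto

theorem imp (hP : LTFormula.Definable P) (hR : LTFormula.Definable R) :
    LTFormula.Definable fun G s => P G s → R G s :=
  (hP.and hR.not).not.congr fun _ _ => by tauto

theorem iff (hP : LTFormula.Definable P) (hR : LTFormula.Definable R) :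
    LTFormula.Definable fun G s => P G s ↔ R G s :=
  ((hP.imp hR).and (hR.imp hP)).congr fun _ _ => by tauto

theorem input {D : List A → Prop} (hD : MSO.Definable fun w (_ : Fin 0 → Fin w.length)
    (_ : Fin 0 → Set (Fin w.length)) => D w) :
    LTFormula.Definable fun (G : OGraph A B) _ => D G.input :=
  let ⟨φ, hφ⟩ := hD
  ⟨.inp0 φ, fun _ _ => hφ _ _ _⟩

theorem input₁ {D : (w : List A) → Fin w.length → Prop}
    (hD : MSO.Definable fun w (s : Fin 1 → Fin w.length)
      (_ : Fin 0 → Set (Fin w.length)) => D w (s 0)) (t : LTTerm) :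
    LTFormula.Definable fun (G : OGraph A B) s => ∃ i, t.eval G s = .inl i ∧ D G.input i :=
  let ⟨φ, hφ⟩ := hD
  ⟨.inp1 φ t, fun _ _ => exists_congr fun _ => and_congr_right fun _ => hφ _ _ _⟩

theorem input₂ {D : (w : List A) → Fin w.length → Fin w.length → Prop}
    (hD : MSO.Definable fun w (s : Fin 2 → Fin w.length)
      (_ : Fin 0 → Set (Fin w.length)) => D w (s 0) (s 1)) (t t' : LTTerm) :
    LTFormula.Definable fun (G : OGraph A B) s =>
      ∃ i i', t.eval G s = .inl i ∧ t'.eval G s = .inl i' ∧ D G.input i i' :=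
  let ⟨φ, hφ⟩ := hD
  ⟨.inp2 φ t t', fun _ _ => exists_congr fun _ => exists_congr fun _ =>
    and_congr_right fun _ => and_congr_right fun _ => hφ _ _ _⟩

theorem const (p : Prop) : LTFormula.Definable fun (_ : OGraph A B) _ => p :=
  input (MSO.Definable.const p)

theorem exists_finite {ι : Type*} [Finite ι]
    {F : ι → (G : OGraph A B) → (LTVar → G.Node) → Prop}
    (hF : ∀ k, LTFormula.Definable (F k)) : LTFormula.Definable fun G s => ∃ k, F k G s := by
  classical
  have := Fintype.ofFinite ι
  have key : ∀ t : Finset ι, LTFormula.Definable fun G s => ∃ k ∈ t, F k G s := by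
    intro t
    induction t using Finset.induction_on with
    | empty => exact (const False).congr fun _ _ => by simp
    | insert k t _ ih => exact ((hF k).or ih).congr fun _ _ => by simp
  exact (key Finset.univ).congr fun _ _ => by simp

theorem forall_finite {ι : Type*} [Finite ι]
    {F : ι → (G : OGraph A B) → (LTVar → G.Node) → Prop}
    (hF : ∀ k, LTFormula.Definable (F k)) : LTFormula.Definable fun G s => ∀ k, F k G s :=
  (exists_finite fun k => (hF k).not).not.congr fun _ _ => by simp

theorem ex (hP : LTFormula.Definable P) (z : LTVar) :
    LTFormula.Definable fun G s => ∃ p, P G (Function.update s z p) :=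
  let ⟨φ, hφ⟩ := hP
  ⟨.ex z φ, fun G _ => exists_congr fun _ => hφ G _⟩

theorem all (hP : LTFormula.Definable P) (z : LTVar) :
    LTFormula.Definable fun G s => ∀ p, P G (Function.update s z p) :=
  (hP.not.ex z).not.congr fun _ _ => by simp

theorem letter (b : B) (t : LTTerm) : LTFormula.Definable fun (G : OGraph A B) s =>
    ∃ j, t.eval G s = .inr j ∧ G.output.get j = b :=
  ⟨.letter b t, fun _ _ => Iff.rfl⟩

theorem leOut (t t' : LTTerm) : LTFormula.Definable fun (G : OGraph A B) s =>
    ∃ j j', t.eval G s = .inr j ∧ t'.eval G s = .inr j' ∧ j ≤ j' :=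
  ⟨.leOut t t', fun _ _ => Iff.rfl⟩

/-- A definable property yields a sentence: both variables are closed by a universal
quantifier. -/
theorem isLTDefinable (hP : LTFormula.Definable P) :
    OTransduction.IsLTDefinable {G : OGraph A B | ∀ s, P G s} := by
  obtain ⟨φ, hφ⟩ := hP
  refine ⟨.neg (.ex .x (.ex .y (.neg φ))), ?_, ?_⟩
  · ext z
    cases z <;> simp [LTFormula.free]
  · ext G
    simp only [LTFormula.oSem, LTFormula.Holds, hφ, Set.mem_ofPred_eq, not_exists, not_not]
    constructor
    · intro h s
      simpa using h s (s .x) (s .y)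
    · exact fun h s p q => h _

end LTFormula.Definable

/-! ### Interpretations of words in words -/

/-- A deterministic MSO-transducer given by the relations that its formulas define, with an
arbitrary type `C` of copies. -/
structure WordInterpretation (A : Type u) (B : Type v) (C : Type) where
  dom : List A → Prop
  pos : C → (w : List A) → Fin w.length → Prop
  lab : C → B → (w : List A) → Fin w.length → Prop
  ord : C → C → (w : List A) → Fin w.length → Fin w.length → Prop
  dom_def : MSO.Definable fun w (_ : Fin 0 → Fin w.length)
    (_ : Fin 0 → Set (Fin w.length)) => dom w
  pos_def : ∀ c, MSO.Definable fun w (s : Fin 1 → Fin w.length)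
    (_ : Fin 0 → Set (Fin w.length)) => pos c w (s 0)
  lab_def : ∀ c b, MSO.Definable fun w (s : Fin 1 → Fin w.length)
    (_ : Fin 0 → Set (Fin w.length)) => lab c b w (s 0)
  ord_def : ∀ c d, MSO.Definable fun w (s : Fin 2 → Fin w.length)
    (_ : Fin 0 → Set (Fin w.length)) => ord c d w (s 0) (s 1)

namespace WordInterpretation

variable {A : Type u} {B : Type v} {C : Type} (I : WordInterpretation A B C)

/-- The map `c`, which sends an output position to a copy of its origin, is an isomorphism from the
output of `G` to the structure interpreted in the input of `G`. (It is injective as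
a map to copies of positions because it preserves and reflects the order.) -/
structure IsLabelling (G : OGraph A B) (c : Fin G.output.length → C) : Prop where
  pos : ∀ j, I.pos (c j) G.input (G.origin j)
  surj : ∀ d i, I.pos d G.input i → ∃ j, G.origin j = i ∧ c j = d
  lab : ∀ j b, G.output.get j = b ↔ I.lab (c j) b G.input (G.origin j)
  ord : ∀ j j', j ≤ j' ↔ I.ord (c j) (c j') G.input (G.origin j) (G.origin j')

/-- The o-transduction of an interpretation. -/
def oSem : OTransduction A B := {G | I.dom G.input ∧ ∃ c, I.IsLabelling G c}

/-- The copies of the position `i` that are kept and strictly precede its copy `d`. -/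
def copiesBelow (d : C) (w : List A) (i : Fin w.length) : Set C :=
  {d' | I.pos d' w i ∧ I.ord d' d w i i ∧ ¬ I.ord d d' w i i}

end WordInterpretation

/-! ### Ranks within the fibres of the origin map -/

/-- The output positions before `j` that have the same origin as `j`. -/
def OGraph.fibreBelow {A : Type u} {B : Type v} (G : OGraph A B) (j : Fin G.output.length) :
    Set (Fin G.output.length) :=
  {j' | j' < j ∧ G.origin j' = G.origin j}

/-- The rank of an output position among those of the same origin. -/
noncomputable def OGraph.rank {A : Type u} {B : Type v} (G : OGraph A B)
    (j : Fin G.output.length) : ℕ :=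
  (G.fibreBelow j).ncard

section Rank

variable {A : Type u} {B : Type v} (G : OGraph A B)

theorem OGraph.rank_lt_rank {j j' : Fin G.output.length} (h : j' < j)
    (ho : G.origin j' = G.origin j) : G.rank j' < G.rank j := by
  refine Set.ncard_lt_ncard ⟨fun k hk => ⟨hk.1.trans h, hk.2.trans ho⟩, fun hs => ?_⟩
  exact lt_irrefl _ (hs (⟨h, ho⟩ : j' ∈ G.fibreBelow j)).1

theorem OGraph.eq_of_rank_eq {j j' : Fin G.output.length} (h : G.rank j' = G.rank j)
    (ho : G.origin j' = G.origin j) : j' = j := by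
  rcases lt_trichotomy j' j with hlt | rfl | hlt
  · exact absurd h (G.rank_lt_rank hlt ho).ne
  · rfl
  · exact absurd h (G.rank_lt_rank hlt ho.symm).ne'

/-- The recursion through which two variables are enough to define the rank. -/
theorem OGraph.succ_le_rank_iff {r : ℕ} {j : Fin G.output.length} :
    r + 1 ≤ G.rank j ↔ ∃ j', j' < j ∧ G.origin j' = G.origin j ∧ r ≤ G.rank j' := by
  constructor
  · intro h
    have hne : (G.fibreBelow j).Nonempty := by
      rw [← Set.ncard_pos]
      exact Nat.lt_of_lt_of_le r.succ_pos h
    obtain ⟨m, hm, hmax⟩ := Set.exists_max_image (G.fibreBelow j) id (Set.toFinite _) hne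
    refine ⟨m, hm.1, hm.2, ?_⟩
    -- `m` is the last position of the fibre before `j`.
    have hsub : G.fibreBelow j ⊆ insert m (G.fibreBelow m) := by
      intro k hk
      rcases (hmax k hk).eq_or_lt with h | h
      · exact Or.inl h
      · exact Or.inr ⟨h, hk.2.trans hm.2.symm⟩
    have := (Set.ncard_le_ncard hsub).trans (Set.ncard_insert_le _ _)
    exact Nat.succ_le_succ_iff.1 (h.trans this)
  · rintro ⟨j', hlt, ho, hr⟩
    exact Nat.succ_le_of_lt (hr.trans_lt (G.rank_lt_rank hlt ho))

/-- The variable other than `z`. -/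
def LTVar.other : LTVar → LTVar
  | .x => .y
  | .y => .x

theorem LTVar.other_ne (z : LTVar) : z.other ≠ z := by
  cases z <;> simp [LTVar.other]

namespace LTFormula.Definable

theorem isOutput (z : LTVar) : LTFormula.Definable fun (_ : OGraph A B) s =>
    ∃ j, s z = .inr j :=
  (leOut (.var z) (.var z)).congr fun _ _ =>
    ⟨fun ⟨j, _, hj, _⟩ => ⟨j, hj⟩, fun ⟨j, hj⟩ => ⟨j, j, hj, hj, le_rfl⟩⟩

/-- Two nodes have the same origin; an input position is its own origin. -/
theorem sameOrigin (z z' : LTVar) : LTFormula.Definable fun (G : OGraph A B) s =>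
    ∃ i, G.originNode (s z) = .inl i ∧ G.originNode (s z') = .inl i :=
  (input₂ (D := fun _ i i' => i = i') (MSO.Definable.eq 0 1) (.orig (.var z))
    (.orig (.var z'))).congr fun G s => by simp [LTTerm.eval]

theorem le_rank (r : ℕ) (z : LTVar) : LTFormula.Definable fun (G : OGraph A B) s =>
    ∃ j, s z = .inr j ∧ r ≤ G.rank j := by
  induction r generalizing z with
  | zero => exact (isOutput z).congr fun _ _ => by simp
  | succ r ih =>
    have h := (((leOut (A := A) (B := B) (.var z) (.var z.other)).not.and
      (leOut (.var z) (.var z))).and ((sameOrigin z.other z).and (ih z.other))).ex z.other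
    refine h.congr fun G s => ?_
    simp only [LTTerm.eval, Function.update_self, Function.update_of_ne z.other_ne.symm,
      G.succ_le_rank_iff]
    constructor
    · rintro ⟨p, ⟨h₁, j, _, hj, _⟩, ⟨i, hi, hi'⟩, j', rfl, hr⟩
      rw [hj] at hi'
      refine ⟨j, hj, j', not_le.1 fun hle => h₁ ⟨j, j', hj, rfl, hle⟩, ?_, hr⟩
      exact (Sum.inl.inj hi).trans (Sum.inl.inj hi').symm
    · rintro ⟨j, hj, j', hlt, ho, hr⟩
      refine ⟨.inr j', ⟨?_, j, j, hj, hj, le_rfl⟩, ⟨G.origin j', rfl, ?_⟩, j', rfl, hr⟩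
      · rintro ⟨k, k', hk, hk', hle⟩
        rw [hj] at hk
        cases hk
        cases hk'
        exact absurd hlt hle.not_gt
      · rw [hj, ho]
        rfl

theorem rank_eq (r : ℕ) (z : LTVar) : LTFormula.Definable fun (G : OGraph A B) s =>
    ∃ j, s z = .inr j ∧ G.rank j = r :=
  ((le_rank r z).and (le_rank (r + 1) z).not).congr fun G s => by
    constructor
    · rintro ⟨⟨j, hj, hr⟩, h⟩
      exact ⟨j, hj, le_antisymm (Nat.le_of_not_lt fun hlt => h ⟨j, hj, hlt⟩) hr⟩
    · rintro ⟨j, hj, hr⟩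
      refine ⟨⟨j, hj, hr.ge⟩, ?_⟩
      rintro ⟨j', hj', hr'⟩
      rw [hj] at hj'
      cases hj'
      omega

end LTFormula.Definable

end Rank

/-! ### Interpretations in the two-variable logic -/

namespace WordInterpretation

variable {A : Type u} {B : Type v} {C : Type} (I : WordInterpretation A B C)

/-- The output position `j` is the image of the copy `d` of its origin, as far as ranks tell. -/
def IsCopy (G : OGraph A B) (d : C) (j : Fin G.output.length) : Prop :=
  I.pos d G.input (G.origin j) ∧ G.rank j = (I.copiesBelow d G.input (G.origin j)).ncard

/-- Ranks never exceed the number of copies, so comparing them is a finite disjunction. -/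
theorem isCopy_definable [Finite C] (d : C) (z : LTVar) :
    LTFormula.Definable fun (G : OGraph A B) s => ∃ j, s z = .inr j ∧ I.IsCopy G d j := by
  have hr (r : ℕ) : MSO.Definable fun w (s : Fin 1 → Fin w.length)
      (_ : Fin 0 → Set (Fin w.length)) =>
      I.pos d w (s 0) ∧ (I.copiesBelow d w (s 0)).ncard = r :=
    (I.pos_def d).and <| MSO.Definable.of_finite_set (fun D : Set C => D.ncard = r) fun d' =>
      (I.pos_def d').and (((I.ord_def d' d).rename (fun _ => 0) id).and
        ((I.ord_def d d').rename (fun _ => 0) id).not)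
  have h : LTFormula.Definable fun (G : OGraph A B) s => ∃ r : Fin (Nat.card C + 1),
      (∃ j, s z = .inr j ∧ G.rank j = r) ∧
      ∃ i, (LTTerm.orig (.var z)).eval G s = .inl i ∧ I.pos d G.input i ∧
        (I.copiesBelow d G.input i).ncard = r :=
    .exists_finite fun r => (LTFormula.Definable.rank_eq r z).and
      (.input₁ (D := fun w i => I.pos d w i ∧ (I.copiesBelow d w i).ncard = r) (hr r) _)
  refine h.congr fun G s => ?_
  constructor
  · rintro ⟨r, ⟨j, hj, hr⟩, i, hi, hpos, hc⟩
    simp only [LTTerm.eval, hj, OGraph.originNode, Sum.inl.injEq] at hi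
    subst hi
    exact ⟨j, hj, hpos, hr.trans hc.symm⟩
  · rintro ⟨j, hj, hpos, hr⟩
    refine ⟨⟨_, Nat.lt_succ_of_le (Set.ncard_le_card
      (I.copiesBelow d G.input (G.origin j)))⟩, ⟨j, hj, hr⟩, G.origin j, ?_, hpos, rfl⟩
    simp [LTTerm.eval, hj, OGraph.originNode]

variable {I} {G : OGraph A B}

/-- An isomorphism preserves ranks: the one between the output and the interpreted structure is
therefore determined by the ranks. -/
theorem IsLabelling.isCopy_iff {c : Fin G.output.length → C} (hc : I.IsLabelling G c) (d : C)
    (j : Fin G.output.length) : I.IsCopy G d j ↔ c j = d := by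
  have hlt (j j') : j < j' ↔ I.ord (c j) (c j') G.input (G.origin j) (G.origin j') ∧
      ¬ I.ord (c j') (c j) G.input (G.origin j') (G.origin j) := by
    rw [← hc.ord, ← hc.ord, lt_iff_le_not_ge]
  have hcopy (j) : G.rank j = (I.copiesBelow (c j) G.input (G.origin j)).ncard := by
    refine Set.ncard_congr (fun j' _ => c j') ?_ ?_ ?_
    · rintro j' ⟨h, ho⟩
      have h' := (hlt j' j).1 h
      have hp := hc.pos j'
      rw [ho] at h' hp
      exact ⟨hp, h'⟩
    · rintro j₁ j₂ ⟨_, ho₁⟩ ⟨_, ho₂⟩ h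
      have h₁ := (hc.ord j₁ j₁).1 le_rfl
      refine le_antisymm ((hc.ord _ _).2 ?_) ((hc.ord _ _).2 ?_)
      · rwa [← h, ho₂, ← ho₁]
      · rwa [← h, ho₂, ← ho₁]
    · rintro d' ⟨hp, h⟩
      obtain ⟨j', ho, rfl⟩ := hc.surj d' _ hp
      refine ⟨j', ⟨(hlt j' j).2 ?_, ho⟩, rfl⟩
      rwa [ho]
  constructor
  · rintro ⟨hp, hr⟩
    obtain ⟨j', ho, rfl⟩ := hc.surj d _ hp
    rw [← ho, ← hcopy j'] at hr
    rw [G.eq_of_rank_eq hr.symm ho]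
  · rintro rfl
    exact ⟨hc.pos j, hcopy j⟩

variable (I)

/-- With the isomorphism expressed through ranks, only quantifiers over at most two nodes at a time
remain, as the two-variable logic requires. -/
theorem mem_oSem_iff : G ∈ I.oSem ↔ I.dom G.input ∧
    (∀ j, ∃ d, I.IsCopy G d j ∧ ∀ d', I.IsCopy G d' j → d' = d) ∧
    (∀ d i, I.pos d G.input i → ∃ j, G.origin j = i ∧ I.IsCopy G d j) ∧
    (∀ d b j, I.IsCopy G d j → (G.output.get j = b ↔ I.lab d b G.input (G.origin j))) ∧
    ∀ d d' j j', I.IsCopy G d j → I.IsCopy G d' j' →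
      (j ≤ j' ↔ I.ord d d' G.input (G.origin j) (G.origin j')) := by
  refine and_congr_right fun _ => ⟨?_, ?_⟩
  · rintro ⟨c, hc⟩
    simp only [hc.isCopy_iff]
    refine ⟨fun j => ⟨c j, rfl, fun d' h => h.symm⟩, hc.surj, ?_, ?_⟩
    · rintro _ b j rfl
      exact hc.lab j b
    · rintro _ _ j j' rfl rfl
      exact hc.ord j j'
  · rintro ⟨h₁, h₂, h₃, h₄⟩
    choose c hc hu using h₁
    refine ⟨c, fun j => (hc j).1, fun d i hd => ?_, fun j b => h₃ _ _ _ (hc j),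
      fun j j' => h₄ _ _ _ _ (hc j) (hc j')⟩
    obtain ⟨j, ho, hj⟩ := h₂ d i hd
    exact ⟨j, ho, (hu j d hj).symm⟩

/-- The o-transduction of an interpretation is definable in the two-variable logic. -/
theorem isLTDefinable_oSem [Finite B] [Finite C] : I.oSem.IsLTDefinable := by
  have hcopy := I.isCopy_definable
  have h₁ := ((LTFormula.Definable.isOutput .x).imp (.exists_finite fun d => (hcopy d .x).and
    (.forall_finite fun d' => (hcopy d' .x).imp (.const (d' = d))))).all .x
  have h₂ := LTFormula.Definable.forall_finite fun d =>
    ((LTFormula.Definable.input₁ (I.pos_def d) (.var .x)).imp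
      (((LTFormula.Definable.sameOrigin .y .x).and (hcopy d .y)).ex .y)).all .x
  have h₃ := LTFormula.Definable.forall_finite fun d => .forall_finite fun b =>
    ((hcopy d .x).imp ((LTFormula.Definable.letter b (.var .x)).iff
      (.input₁ (I.lab_def d b) (.orig (.var .x))))).all .x
  have h₄ := LTFormula.Definable.forall_finite fun d => .forall_finite fun d' =>
    ((((hcopy d .x).imp ((hcopy d' .y).imp ((LTFormula.Definable.leOut (.var .x) (.var .y)).iff
      (.input₂ (I.ord_def d d') (.orig (.var .x)) (.orig (.var .y)))))).all .y).all .x)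
  have h := ((LTFormula.Definable.input I.dom_def).and (h₁.and (h₂.and (h₃.and h₄))))
  convert h.isLTDefinable using 1
  ext G
  have hne : Nonempty (LTVar → G.Node) :=
    ⟨fun _ => .inl ⟨0, List.length_pos_iff.2 G.input_ne⟩⟩
  simp [I.mem_oSem_iff, LTTerm.eval, OGraph.originNode, eq_comm]

end WordInterpretation

/-- The interpretation given by the formulas of an MSO-transducer. -/
def MSOTransducer.toInterpretation {A : Type u} {B : Type v} (T : MSOTransducer A B) :
    WordInterpretation A B (Fin T.copies) where
  dom w := T.dom.Rel w ![]
  pos c w i := (T.pos c).Rel w ![i]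
  lab c b w i := (T.lab c b).Rel w ![i]
  ord c d w i i' := (T.ord c d).Rel w ![i, i']
  dom_def := ⟨T.dom, fun w s S => by
    rw [Subsingleton.elim s ![], Subsingleton.elim S Fin.elim0]; rfl⟩
  pos_def c := ⟨T.pos c, fun w s S => by
    have h : ![s 0] = s := FinVec.etaExpand_eq s
    change _ ↔ MSO.Holds w (T.pos c) ![s 0] Fin.elim0
    rw [Subsingleton.elim S Fin.elim0, h]⟩
  lab_def c b := ⟨T.lab c b, fun w s S => by
    have h : ![s 0] = s := FinVec.etaExpand_eq s
    change _ ↔ MSO.Holds w (T.lab c b) ![s 0] Fin.elim0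
    rw [Subsingleton.elim S Fin.elim0, h]⟩
  ord_def c d := ⟨T.ord c d, fun w s S => by
    have h : ![s 0, s 1] = s := FinVec.etaExpand_eq s
    change _ ↔ MSO.Holds w (T.ord c d) ![s 0, s 1] Fin.elim0
    rw [Subsingleton.elim S Fin.elim0, h]⟩

theorem MSOTransducer.oSem_toInterpretation {A : Type u} {B : Type v} (T : MSOTransducer A B) :
    T.toInterpretation.oSem = T.oSem := by
  ext G
  refine and_congr_right fun _ => ⟨?_, ?_⟩
  · rintro ⟨c, hc⟩
    refine ⟨Equiv.ofBijective (fun j => ⟨(c j, G.origin j), hc.pos j⟩) ⟨?_, ?_⟩,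
      fun _ => rfl, hc.lab, hc.ord⟩
    · intro j j' h
      obtain ⟨h₁, h₂⟩ := Prod.ext_iff.1 (Subtype.ext_iff.1 h)
      simp only at h₁ h₂
      have h := (hc.ord j j).1 le_rfl
      refine le_antisymm ((hc.ord _ _).2 ?_) ((hc.ord _ _).2 ?_)
      · rwa [← h₁, ← h₂]
      · rwa [← h₁, ← h₂]
    · rintro ⟨⟨d, i⟩, hd⟩
      obtain ⟨j, rfl, rfl⟩ := hc.surj d i hd
      exact ⟨j, rfl⟩
  · rintro ⟨e, ho, hl, hle⟩
    refine ⟨fun j => (e j).1.1, fun j => ?_, fun d i hd => ?_, fun j b => ?_, fun j j' => ?_⟩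
    · rw [ho]
      exact (e j).2
    · obtain ⟨j, hj⟩ := e.surjective ⟨(d, i), hd⟩
      exact ⟨j, by rw [ho, hj], by rw [hj]⟩
    · rw [ho]
      exact hl j b
    · rw [ho, ho]
      exact hle j j'

/-! ### Configurations of a two-way transducer -/

/-- The three kinds of cells of a tape. -/
inductive CellKind
  | left
  | inner
  | right

instance : Finite CellKind :=
  Finite.of_surjective (fun i : Fin 3 => ![CellKind.left, .inner, .right] i) fun k => by
    cases k
    exacts [⟨0, rfl⟩, ⟨1, rfl⟩, ⟨2, rfl⟩]

instance : Finite Move :=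
  Finite.of_surjective (fun i : Fin 3 => ![Move.left, .stay, .right] i) fun k => by
    cases k
    exacts [⟨0, rfl⟩, ⟨1, rfl⟩, ⟨2, rfl⟩]

instance {A : Type u} [Finite A] : Finite (TapeSymbol A) :=
  Finite.of_surjective
    (fun o : Option (Option A) => o.elim TapeSymbol.left fun o => o.elim .right .letter) fun k => by
    cases k
    exacts [⟨none, rfl⟩, ⟨some (some _), rfl⟩, ⟨some none, rfl⟩]

/-- The cell of the kind `k` that is attached to the position `i` of a word of length `n`. The
endmarkers are attached to the first and to the last position, see `CellKind.Valid`. -/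
def CellKind.cell (n : ℕ) (i : ℕ) : CellKind → ℕ
  | .left => 0
  | .inner => i + 1
  | .right => n + 1

/-- A cell of the kind `k` is attached to the position `i`. -/
def CellKind.Valid (n : ℕ) (i : ℕ) : CellKind → Prop
  | .left => i = 0
  | .inner => True
  | .right => i + 1 = n

theorem CellKind.cell_injective {n i i' : ℕ} {k k' : CellKind} (hi : i < n) (hi' : i' < n)
    (hk : k.Valid n i) (hk' : k'.Valid n i') (h : k.cell n i = k'.cell n i') :
    k = k' ∧ i = i' := by
  cases k <;> cases k' <;> simp only [Valid, cell, true_and, false_and, reduceCtorEq] at * <;> omega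

theorem CellKind.cellOrigin_cell {n i : ℕ} {k : CellKind} (hi : i < n) (hk : k.Valid n i) :
    cellOrigin n (k.cell n i) = i := by
  cases k <;> simp only [Valid, cell, cellOrigin] at * <;> omega

theorem CellKind.cell_le (n : ℕ) {i : ℕ} (k : CellKind) (hi : i < n) : k.cell n i ≤ n + 1 := by
  cases k <;> simp only [cell] <;> omega

theorem CellKind.exists_cell_eq {n p : ℕ} (hn : 0 < n) (hp : p ≤ n + 1) :
    ∃ (k : CellKind) (i : Fin n), k.Valid n i ∧ k.cell n i = p := by
  rcases Nat.eq_zero_or_pos p with rfl | h0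
  · exact ⟨.left, ⟨0, hn⟩, rfl, rfl⟩
  rcases hp.eq_or_lt with rfl | h1
  · exact ⟨.right, ⟨n - 1, by omega⟩, Nat.sub_add_cancel hn, rfl⟩
  · exact ⟨.inner, ⟨p - 1, by omega⟩, trivial, Nat.sub_add_cancel h0⟩

/-- Configurations of a two-way transducer on a word of length `n`: a state, and a cell given by its
kind and the position to which it is attached. -/
abbrev TwoWayConf (Q : Type) (n : ℕ) : Type := (Q × CellKind) × Fin n

namespace TwoWayConf

variable {Q : Type} {n : ℕ}

/-- The state of a configuration. -/
abbrev state (x : TwoWayConf Q n) : Q := x.1.1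

/-- The number of the cell on which the head is. -/
abbrev cell (x : TwoWayConf Q n) : ℕ := x.1.2.cell n x.2

/-- The position is the one to which the cell is attached. Without this condition, several
triples would represent the same configuration. -/
abbrev Valid (x : TwoWayConf Q n) : Prop := x.1.2.Valid n x.2

theorem ext_of_valid {x y : TwoWayConf Q n} (hx : x.Valid) (hy : y.Valid)
    (hs : x.state = y.state) (hc : x.cell = y.cell) : x = y := by
  obtain ⟨hk, hi⟩ := CellKind.cell_injective x.2.2 y.2.2 hx hy hc
  exact Prod.ext (Prod.ext hs hk) (Fin.ext hi)

end TwoWayConf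

namespace TwoWayTransducer

variable {A : Type u} {B : Type v} {Q : Type} (T : TwoWayTransducer A B Q) (w : List A)

/-- The word output by the transition for the state `q` and the symbol `a`; it is empty if there is
no transition. -/
def emit (q : Q) (a : TapeSymbol A) : List B := (T.trans q a).elim [] fun t => t.2.2

/-- The symbol read in a configuration. -/
abbrev read (x : TwoWayConf Q w.length) : TapeSymbol A := tapeSymbol w x.cell

/-- The step relation between configurations. -/
def Step (x y : TwoWayConf Q w.length) : Prop :=
  y.Valid ∧ ∃ d l, T.trans x.state (read w x) = some (y.state, d, l) ∧ d.apply x.cell = y.cell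

/-- The configuration `x` is reachable from the initial one. -/
def Reach (x : TwoWayConf Q w.length) : Prop :=
  ∃ i : Fin w.length, (i : ℕ) = 0 ∧ Relation.ReflTransGen (T.Step w) ((T.init, .left), i) x

/-- The transducer stops in the configuration `x`. -/
def Halts (x : TwoWayConf Q w.length) : Prop := T.trans x.state (read w x) = none

variable {T w}

theorem Step.unique {x y y' : TwoWayConf Q w.length} (h : T.Step w x y) (h' : T.Step w x y') :
    y = y' := by
  obtain ⟨hv, d, l, ht, hd⟩ := h
  obtain ⟨hv', d', l', ht', hd'⟩ := h'
  obtain ⟨hs, rfl, rfl⟩ := by simpa using ht.symm.trans ht'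
  exact TwoWayConf.ext_of_valid hv hv' hs (hd.symm.trans hd')

theorem Halts.not_step {x y : TwoWayConf Q w.length} (hx : T.Halts w x) : ¬ T.Step w x y := by
  rintro ⟨_, d, l, ht, _⟩
  rw [Halts] at hx
  simp [hx] at ht

/-- A deterministic run that halts does not loop. -/
theorem not_transGen_self {x y : TwoWayConf Q w.length}
    (h : Relation.ReflTransGen (T.Step w) x y) (hy : T.Halts w y) :
    ¬ Relation.TransGen (T.Step w) x x := by
  induction h using Relation.ReflTransGen.head_induction_on with
  | refl =>
    intro h
    obtain ⟨z, hz, _⟩ := Relation.TransGen.head'_iff.1 h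
    exact hy.not_step hz
  | head h _ ih =>
    intro hx
    obtain ⟨z, hz, hzx⟩ := Relation.TransGen.head'_iff.1 hx
    cases h.unique hz
    exact ih (Relation.TransGen.tail' hzx h)

theorem Reach.exists_run {x : TwoWayConf Q w.length} (h : T.Reach w x) :
    x.Valid ∧ ∃ out, T.Run w x.state x.cell out := by
  obtain ⟨i, hi, h⟩ := h
  induction h with
  | refl => exact ⟨hi, [], .init⟩
  | tail _ h ih =>
    obtain ⟨_, out, hr⟩ := ih
    obtain ⟨hv, d, l, ht, hd⟩ := h
    have := hr.step ht
    rw [hd] at this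
    exact ⟨hv, _, this⟩

/-- The tape has no cell beyond the endmarkers, so each step of a run is a step between
configurations. -/
theorem exists_step {x : TwoWayConf Q w.length} {q : Q} {d : Move} {l : List B}
    (ht : T.trans x.state (read w x) = some (q, d, l)) :
    ∃ y, T.Step w x y ∧ y.state = q ∧ y.cell = d.apply x.cell := by
  have hle : d.apply x.cell ≤ w.length + 1 := by
    have hx : x.cell ≤ w.length + 1 := x.1.2.cell_le _ x.2.2
    cases d with
    | left => exact (Nat.sub_le _ _).trans hx
    | stay => exact hx
    | right =>
      rcases hx.eq_or_lt with h | h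
      · have hr : tapeSymbol w (w.length + 1) = .right := by simp [tapeSymbol]
        rw [read, h, hr] at ht
        exact absurd ht (T.no_right _ _ _)
      · exact h
  obtain ⟨k, i, hv, hc⟩ := CellKind.exists_cell_eq (Fin.pos x.2) hle
  exact ⟨((q, k), i), ⟨hv, d, l, ht, hc.symm⟩, rfl, hc⟩

/-- A run passes through the list `cs` of configurations before its last one `y`: in the order of
the run, together with `y` without repetition as long as there is no loop, and leaving out
no reachable configuration but those that come after `y`. -/
theorem Run.exists_trace {q : Q} {p : ℕ} {out : List (B × ℕ)} (h : T.Run w q p out)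
    (hw : 0 < w.length) :
    ∃ (y : TwoWayConf Q w.length) (cs : List (TwoWayConf Q w.length)),
      y.state = q ∧ y.cell = p ∧ T.Reach w y ∧ (∀ x ∈ cs, T.Reach w x) ∧
      cs.Pairwise (Relation.TransGen (T.Step w)) ∧
      (∀ x ∈ cs, Relation.TransGen (T.Step w) x y) ∧
      (∀ x, T.Reach w x → x ∈ cs ∨ Relation.ReflTransGen (T.Step w) y x) ∧
      out = cs.flatMap fun x => (T.emit x.state (read w x)).map fun b => (b, (x.2 : ℕ)) := by
  induction h with
  | init =>
    refine ⟨((T.init, .left), ⟨0, hw⟩), [], rfl, rfl, ⟨⟨0, hw⟩, rfl, .refl⟩, by simp, by simp,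
      by simp, ?_, rfl⟩
    rintro x ⟨i, hi, hx⟩
    obtain rfl : i = ⟨0, hw⟩ := Fin.ext hi
    exact Or.inr hx
  | @step q p out q' d l _ ht ih =>
    obtain ⟨y, cs, rfl, rfl, ⟨i, hi, hy⟩, hcs, hpw, hlast, hall, rfl⟩ := ih
    obtain ⟨z, hz, hzq, hzc⟩ := exists_step ht
    refine ⟨z, cs ++ [y], hzq, hzc, ⟨i, hi, hy.tail hz⟩, ?_, ?_, ?_, ?_, ?_⟩
    · intro x hx
      rcases List.mem_append.1 hx with hx | hx
      · exact hcs x hx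
      · rw [List.mem_singleton.1 hx]
        exact ⟨i, hi, hy⟩
    · rw [List.pairwise_append]
      refine ⟨hpw, List.pairwise_singleton _ _, fun x hx x' hx' => ?_⟩
      rw [List.mem_singleton.1 hx']
      exact hlast x hx
    · intro x hx
      rcases List.mem_append.1 hx with hx | hx
      · exact (hlast x hx).tail hz
      · rw [List.mem_singleton.1 hx]
        exact .single hz
    · intro x hx
      rcases hall x hx with h | h
      · exact Or.inl (List.mem_append_left _ h)
      · rcases Relation.ReflTransGen.cases_head h with rfl | ⟨z', hz', h⟩
        · exact Or.inl (by simp)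
        · cases hz.unique hz'
          exact Or.inr h
    · have hv : y.Valid := (Reach.exists_run ⟨i, hi, hy⟩).1
      simp [emit, ht, CellKind.cellOrigin_cell y.2.2 hv]

/-! ### Definability of the steps of a two-way transducer -/

section Definability

theorem read_definable (q : Q) (k : CellKind) (a : TapeSymbol A) {n : ℕ} (i : Fin n) :
    MSO.Definable fun (w : List A) (s : Fin n → Fin w.length)
      (_ : Fin 0 → Set (Fin w.length)) => read w ((q, k), s i) = a := by
  cases k with
  | left => exact .const (TapeSymbol.left = a)
  | right =>
    exact (MSO.Definable.const (TapeSymbol.right = a)).congr fun w s S => by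
      simp [read, tapeSymbol, TwoWayConf.cell, CellKind.cell]
  | inner =>
    cases a with
    | letter a =>
      exact (MSO.Definable.letter a i).congr fun w s S => by
        simp [read, tapeSymbol, TwoWayConf.cell, CellKind.cell]
    | _ =>
      exact (MSO.Definable.const False).congr fun w s S => by
        simp [read, tapeSymbol, TwoWayConf.cell, CellKind.cell]

theorem valid_definable (k : CellKind) {n : ℕ} (i : Fin n) :
    MSO.Definable fun (w : List A) (s : Fin n → Fin w.length)
      (_ : Fin 0 → Set (Fin w.length)) => k.Valid w.length (s i) := by
  cases k
  exacts [.val_eq_zero i, .const True, .val_succ_eq_length i]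

theorem succ_cell_definable (k k' : CellKind) {n : ℕ} (i j : Fin n) :
    MSO.Definable fun (w : List A) (s : Fin n → Fin w.length) (_ : Fin 0 → Set (Fin w.length)) =>
      k.cell w.length (s i) + 1 = k'.cell w.length (s j) := by
  have hF := MSO.Definable.const (A := A) (n := n) (m := 0) False
  cases k <;> cases k'
  · exact hF.congr fun w s S => by simp [CellKind.cell]
  · exact (MSO.Definable.val_eq_zero j).congr fun w s S => by simp [CellKind.cell]
  · exact hF.congr fun w s S => by
      have := (s i).2
      simp only [CellKind.cell, false_iff]; omega
  · exact hF.congr fun w s S => by simp [CellKind.cell]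
  · exact (MSO.Definable.val_eq_val_succ i j).congr fun w s S => by simp [CellKind.cell, eq_comm]
  · exact (MSO.Definable.val_succ_eq_length i).congr fun w s S => by simp [CellKind.cell]
  · exact hF.congr fun w s S => by simp [CellKind.cell]
  · exact hF.congr fun w s S => by
      have := (s j).2
      simp only [CellKind.cell, false_iff]; omega
  · exact hF.congr fun w s S => by simp [CellKind.cell]

theorem move_definable (k k' : CellKind) (d : Move) {n : ℕ} (i j : Fin n) :
    MSO.Definable fun (w : List A) (s : Fin n → Fin w.length) (_ : Fin 0 → Set (Fin w.length)) =>
      d.apply (k.cell w.length (s i)) = k'.cell w.length (s j) := by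
  cases d with
  | right => exact succ_cell_definable k k' i j
  | left =>
    -- The truncated subtraction in `Move.apply` matters only at the cell `0`, that is, `.left`.
    refine ((succ_cell_definable k' k j i).or (.const (k = .left ∧ k' = .left))).congr
      fun w s S => ?_
    cases k <;> cases k' <;> simp [CellKind.cell, Move.apply] <;> omega
  | stay =>
    have hF := MSO.Definable.const (A := A) (n := n) (m := 0) False
    have hT := MSO.Definable.const (A := A) (n := n) (m := 0) True
    cases k <;> cases k'
    · exact hT.congr fun w s S => by simp [CellKind.cell, Move.apply]
    · exact hF.congr fun w s S => by simp [CellKind.cell, Move.apply]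
    · exact hF.congr fun w s S => by simp [CellKind.cell, Move.apply]
    · exact hF.congr fun w s S => by simp [CellKind.cell, Move.apply]
    · exact (MSO.Definable.eq i j).congr fun w s S => by
        simp [CellKind.cell, Move.apply, Fin.ext_iff]
    · exact hF.congr fun w s S => by
        have := (s i).2
        simp only [CellKind.cell, Move.apply, false_iff]; omega
    · exact hF.congr fun w s S => by simp [CellKind.cell, Move.apply]
    · exact hF.congr fun w s S => by
        have := (s j).2
        simp only [CellKind.cell, Move.apply, false_iff]; omega
    · exact hT.congr fun w s S => by simp [CellKind.cell, Move.apply]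

variable [Finite A] (T)

/-- As the alphabet is finite, every condition on the state and the symbol read is definable. -/
theorem of_read_definable (R : Q → TapeSymbol A → Prop) (c : Q × CellKind) {n : ℕ} (i : Fin n) :
    MSO.Definable fun (w : List A) (s : Fin n → Fin w.length) (_ : Fin 0 → Set (Fin w.length)) =>
      R c.1 (read w (c, s i)) :=
  (MSO.Definable.exists_finite fun a => (read_definable c.1 c.2 a i).and
    (.const (R c.1 a))).congr fun w s S => by simp

theorem step_definable (c c' : Q × CellKind) {n : ℕ} (i j : Fin n) :
    MSO.Definable fun (w : List A) (s : Fin n → Fin w.length) (_ : Fin 0 → Set (Fin w.length)) =>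
      T.Step w (c, s i) (c', s j) :=
  ((valid_definable c'.2 j).and (.exists_finite fun d =>
    (of_read_definable (fun q a => ∃ l, T.trans q a = some (c'.1, d, l)) c i).and
      (move_definable c.2 c'.2 d i j))).congr fun w s S => by
    simp only [Step, TwoWayConf.state, TwoWayConf.cell, TwoWayConf.Valid, exists_and_right]

variable [Finite Q]

theorem reflTransGen_definable (c c' : Q × CellKind) {n : ℕ} (i j : Fin n) :
    MSO.Definable fun (w : List A) (s : Fin n → Fin w.length) (_ : Fin 0 → Set (Fin w.length)) =>
      Relation.ReflTransGen (T.Step w) (c, s i) (c', s j) :=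
  .reflTransGen (R := fun w => T.Step w) (fun c c' => step_definable T c c' 0 1) c c' i j

theorem reach_definable (c : Q × CellKind) {n : ℕ} (i : Fin n) :
    MSO.Definable fun (w : List A) (s : Fin n → Fin w.length) (_ : Fin 0 → Set (Fin w.length)) =>
      T.Reach w (c, s i) :=
  ((MSO.Definable.val_eq_zero 0).and
    (reflTransGen_definable T (T.init, .left) c 0 i.succ)).exFO.congr fun _ _ _ => Iff.rfl

end Definability

/-! ### Two-way transducers as interpretations -/

variable (T)

/-- The order of the output letters: `((q, k, l), i)` stands for the letter of index `l` of
the word output in the configuration `((q, k), i)`. -/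
def OutLE (w : List A) {L : ℕ} (a b : (Q × CellKind) × Fin L) (i j : Fin w.length) : Prop :=
  (a.1 = b.1 ∧ i = j ∧ a.2 ≤ b.2) ∨
    (¬ (a.1 = b.1 ∧ i = j) ∧ Relation.ReflTransGen (T.Step w) (a.1, i) (b.1, j))

/-- The interpretation defined by a two-way transducer each of whose transitions outputs at
most `L` letters. The copies of a position are triples of a state, a kind of cells and the
index of a letter in the output of a transition. -/
def toInterpretation [Finite A] [Finite Q] (L : ℕ) :
    WordInterpretation A B ((Q × CellKind) × Fin L) where
  dom w := ∃ c, ∃ i : Fin w.length, T.Reach w (c, i) ∧ T.Halts w (c, i) ∧ c.1 ∈ T.final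
  pos c w i := T.Reach w (c.1, i) ∧ (c.2 : ℕ) < (T.emit c.1.1 (read w (c.1, i))).length
  lab c b w i := (T.emit c.1.1 (read w (c.1, i)))[(c.2 : ℕ)]? = some b
  ord c d w i j := T.OutLE w c d i j
  dom_def := .exists_finite fun c => ((reach_definable T c 0).and
    ((of_read_definable (fun q a => T.trans q a = none) c 0).and
      (.const (c.1 ∈ T.final)))).exFO.congr fun _ _ _ => Iff.rfl
  pos_def c := (reach_definable T c.1 0).and
    (of_read_definable (fun q a => (c.2 : ℕ) < (T.emit q a).length) c.1 0)
  lab_def c b := of_read_definable (fun q a => (T.emit q a)[(c.2 : ℕ)]? = some b) c.1 0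
  ord_def c d := ((MSO.Definable.const (c.1 = d.1)).and
      ((MSO.Definable.eq 0 1).and (.const (c.2 ≤ d.2)))).or
    (((MSO.Definable.const (c.1 = d.1)).and (.eq 0 1)).not.and
      (reflTransGen_definable T c.1 d.1 0 1))

/-- The letters output by an accepting run, as copies of positions, in the order of the run. -/
theorem exists_outputCopies [Finite A] [Finite Q] {L : ℕ}
    (hL : ∀ q a, (T.emit q a).length ≤ L) {w : List A} (hw : 0 < w.length)
    {out : List (B × ℕ)} (h : T.Accepts w out) :
    (T.toInterpretation L).dom w ∧ ∃ N : List (((Q × CellKind) × Fin L) × Fin w.length),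
      N.Pairwise (fun a b => T.OutLE w a.1 b.1 a.2 b.2 ∧ ¬ T.OutLE w b.1 a.1 b.2 a.2) ∧
      (∀ a, a ∈ N ↔ (T.toInterpretation L).pos a.1 w a.2) ∧
      out.map (fun t => (some t.1, t.2)) = N.map fun a =>
        ((T.emit a.1.1.1 (read w (a.1.1, a.2)))[(a.1.2 : ℕ)]?, (a.2 : ℕ)) := by
  obtain ⟨q, p, hrun, hhalt, hfin⟩ := h
  obtain ⟨y, cs, rfl, rfl, hy, hcs, hpw, hlast, hall, rfl⟩ := hrun.exists_trace hw
  refine ⟨⟨y.1, y.2, hy, hhalt, hfin⟩, cs.flatMap fun x =>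
    List.ofFn fun l : Fin (T.emit x.state (read w x)).length =>
      ((x.1, Fin.castLE (hL _ _) l), x.2), ?_, ?_, ?_⟩
  · rw [List.pairwise_flatMap]
    constructor
    · intro x _
      rw [List.pairwise_ofFn]
      intro l l' hll
      have hll' : (l : ℕ) < l' := hll
      constructor
      · exact Or.inl ⟨rfl, rfl, Fin.le_def.2 hll'.le⟩
      · rintro (⟨_, _, h⟩ | ⟨h, _⟩)
        · exact absurd (Fin.le_def.1 h) (not_le.2 hll')
        · exact h ⟨rfl, rfl⟩
    · -- Letters of distinct configurations: reaching back would close a loop in a halting run.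
      refine List.pairwise_iff_forall_sublist.2 ?_
      intro x x' hsub a ha b hb
      have hxx := List.pairwise_iff_forall_sublist.1 hpw hsub
      have hx : x ∈ cs := hsub.subset (by simp)
      have hloop := not_transGen_self (hlast x hx).to_reflTransGen hhalt
      have hne : x ≠ x' := by
        rintro rfl
        exact hloop hxx
      obtain ⟨l, rfl⟩ := (List.mem_ofFn' _ _).1 ha
      obtain ⟨l', rfl⟩ := (List.mem_ofFn' _ _).1 hb
      constructor
      · exact Or.inr ⟨fun h => hne (Prod.ext h.1 h.2), hxx.to_reflTransGen⟩
      · rintro (⟨h₁, h₂, _⟩ | ⟨_, h⟩)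
        · exact hne (Prod.ext h₁.symm h₂.symm)
        · exact hloop (hxx.trans_left h)
  · rintro ⟨⟨c, l⟩, i⟩
    rw [List.mem_flatMap]
    constructor
    · rintro ⟨x, hx, ha⟩
      obtain ⟨l', hl'⟩ := (List.mem_ofFn' _ _).1 ha
      cases hl'
      exact ⟨hcs x hx, l'.2⟩
    · rintro ⟨hr, hl⟩
      refine ⟨(c, i), ?_, (List.mem_ofFn' _ _).2 ⟨⟨l, hl⟩, rfl⟩⟩
      rcases hall _ hr with h | h
      · exact h
      · rcases Relation.ReflTransGen.cases_head h with rfl | ⟨z, hz, _⟩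
        · have hhalt' : T.trans c.1 (read w (c, i)) = none := hhalt
          simp [emit, hhalt'] at hl
        · exact absurd hz (Halts.not_step hhalt)
  · simp only [List.map_flatMap, List.map_map, List.map_ofFn]
    congr 1
    funext x
    apply List.ext_getElem <;> simp

/-- The output order is strict on distinct copies, so an origin graph isomorphic to the interpreted
structure lists the copies in the same order as the accepting run does. -/
theorem oSem_toInterpretation [Finite A] [Finite Q] {L : ℕ}
    (hL : ∀ q a, (T.emit q a).length ≤ L) :
    (T.toInterpretation L).oSem = T.oSem := by
  ext G
  have hw : 0 < G.input.length := List.length_pos_iff.2 G.input_ne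
  constructor
  · rintro ⟨⟨c₀, i₀, hr, hh, hf⟩, c, hc⟩
    obtain ⟨_, out, hrun⟩ := hr.exists_run
    have hacc : T.Accepts G.input out := ⟨_, _, hrun, hh, hf⟩
    obtain ⟨_, N, hpw, hmem, hout⟩ := T.exists_outputCopies hL hw hacc
    have hpw' : (List.ofFn fun j => (c j, G.origin j)).Pairwise
        fun a b => T.OutLE G.input a.1 b.1 a.2 b.2 ∧ ¬ T.OutLE G.input b.1 a.1 b.2 a.2 := by
      rw [List.pairwise_ofFn]
      intro j j' hjj
      exact ⟨(hc.ord j j').1 hjj.le, fun h => hjj.not_ge ((hc.ord j' j).2 h)⟩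
    have hirr : ∀ {l : List (((Q × CellKind) × Fin L) × Fin G.input.length)}, l.Pairwise
        (fun a b => T.OutLE G.input a.1 b.1 a.2 b.2 ∧ ¬ T.OutLE G.input b.1 a.1 b.2 a.2) →
        l.Nodup := fun h => h.imp fun hab => by
      rintro rfl
      exact hab.2 hab.1
    -- Both lists enumerate the kept copies in the order of the output.
    have hN : (List.ofFn fun j => (c j, G.origin j)) = N := by
      refine List.Perm.eq_of_pairwise (fun a b _ _ h h' => absurd h.1 h'.2) hpw' hpw ?_
      rw [List.perm_ext_iff_of_nodup (hirr hpw') (hirr hpw)]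
      rintro ⟨d, i⟩
      rw [hmem, List.mem_ofFn']
      constructor
      · rintro ⟨j, hj⟩
        cases hj
        exact hc.pos j
      · intro hd
        obtain ⟨j, rfl, rfl⟩ := hc.surj d i hd
        exact ⟨j, rfl⟩
    have hinj : Function.Injective fun t : B × ℕ => (some t.1, t.2) := by
      rintro ⟨b, n⟩ ⟨b', n'⟩ h
      simpa using h
    have : (List.ofFn fun j => (G.output.get j, (G.origin j : ℕ))) = out := by
      apply List.map_injective_iff.2 hinj
      rw [hout, ← hN, List.map_ofFn, List.map_ofFn]
      congr 1
      funext j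
      exact Prod.ext ((hc.lab j _).1 rfl).symm rfl
    change T.Accepts _ _
    rwa [this]
  · intro hacc
    obtain ⟨hdom, N, hpw, hmem, hout⟩ := T.exists_outputCopies hL hw hacc
    have hlen : G.output.length = N.length := by simpa using congrArg List.length hout
    have hget : ∀ j : Fin G.output.length,
        (T.emit (N.get (j.cast hlen)).1.1.1
          (read G.input ((N.get (j.cast hlen)).1.1, (N.get (j.cast hlen)).2)))[
            ((N.get (j.cast hlen)).1.2 : ℕ)]? = some (G.output.get j) ∧
        (N.get (j.cast hlen)).2 = G.origin j := by
      intro j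
      have h := congrArg (fun l => l[(j : ℕ)]?) hout
      have hj : (j : ℕ) < N.length := hlen ▸ j.2
      simp [hj] at h
      exact ⟨h.1.symm, Fin.ext h.2.symm⟩
    have hlt : ∀ j j' : Fin G.output.length, j < j' →
        T.OutLE G.input (N.get (j.cast hlen)).1 (N.get (j'.cast hlen)).1 (G.origin j)
          (G.origin j') ∧
        ¬ T.OutLE G.input (N.get (j'.cast hlen)).1 (N.get (j.cast hlen)).1 (G.origin j')
          (G.origin j) := by
      intro j j' hjj
      have := List.pairwise_iff_get.1 hpw (j.cast hlen) (j'.cast hlen) hjj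
      rwa [(hget j).2, (hget j').2] at this
    refine ⟨hdom, fun j => (N.get (j.cast hlen)).1, fun j => ?_, fun d i hd => ?_, fun j b => ?_,
      fun j j' => ?_⟩
    · rw [← (hget j).2]
      exact (hmem _).1 (List.get_mem _ _)
    · obtain ⟨j, hj⟩ := List.get_of_mem ((hmem (d, i)).2 hd)
      refine ⟨j.cast hlen.symm, ?_, ?_⟩
      · rw [← (hget _).2]
        exact congrArg Prod.snd hj
      · exact congrArg Prod.fst hj
    · have h := (hget j).1
      rw [(hget j).2] at h
      change _ ↔ _ = some b
      rw [h, Option.some_inj]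
    · constructor
      · intro h
        rcases h.eq_or_lt with rfl | h
        · exact Or.inl ⟨rfl, rfl, le_rfl⟩
        · exact (hlt j j' h).1
      · intro h
        by_contra hlt'
        exact (hlt j' j (not_le.1 hlt')).2 h

theorem isLTDefinable_oSem [Finite A] [Finite B] [Finite Q] : T.oSem.IsLTDefinable := by
  obtain ⟨L, hL⟩ := (Set.finite_range fun t : Q × TapeSymbol A =>
    (T.emit t.1 t.2).length).bddAbove
  rw [← T.oSem_toInterpretation fun q a => hL ⟨(q, a), rfl⟩]
  exact WordInterpretation.isLTDefinable_oSem _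

end TwoWayTransducer

theorem MSOTransducer.isLTDefinable_oSem {A : Type u} {B : Type v} [Finite B]
    (T : MSOTransducer A B) : T.oSem.IsLTDefinable := by
  rw [← T.oSem_toInterpretation]
  exact WordInterpretation.isLTDefinable_oSem _

theorem OTransduction.IsLTDefinable.originFree {A : Type u} {B : Type v} {τ : OTransduction A B}
    (h : τ.IsLTDefinable) : Transduction.IsLTDefinable τ.originFree := by
  obtain ⟨φ, hφ, rfl⟩ := h
  exact ⟨φ, hφ, rfl⟩

theorem mainTheorem2 {A : Type u} {B : Type v} [Finite A] [Finite B] :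
    (∀ τ : OTransduction A B, τ.IsRegular → τ.IsLTDefinable) ∧
    (∀ τ : OTransduction A B, τ.IsMSOTransduction → τ.IsLTDefinable) ∧
    (∀ f : Transduction A B, f.IsRegular → f.IsLTDefinable) ∧
    (∀ f : Transduction A B, f.IsMSOTransduction → f.IsLTDefinable) := by
  refine ⟨?_, ?_, ?_, ?_⟩
  · rintro _ ⟨Q, _, T, rfl⟩
    exact T.isLTDefinable_oSem
  · rintro _ ⟨T, rfl⟩
    exact T.isLTDefinable_oSem
  · rintro _ ⟨Q, _, T, rfl⟩
    exact T.isLTDefinable_oSem.originFree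
  · rintro _ ⟨T, rfl⟩
    exact T.isLTDefinable_oSem.originFree
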